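/- Theorem 1. Fix integers $Q\ge 0$ (clutter sources) and $N_T$ (transmit antennas), angles $\theta_0,\dots,\theta_Q\in\mathbb R$, complex amplitudes $\gamma_0,\dots,\gamma_Q\in\mathbb C$ (index $0$ is the target, the others are clutter sources), a transmit power $E$ and a noise power $\sigma_R^2>0$. Let $\mathbf g_N(\theta)=\frac1{\sqrt N}\,[1,e^{-j\pi\sin\theta},\dots,e^{-j\pi(N-1)\sin\theta}]^T$ be the steering vector of $N$ antennas. For each number $N_R$ of receive antennas let $\mathbf G_q=\mathbf g_{N_R}(\theta_q)\,\mathbf g_{N_T}(\theta_q)^T$, let $\mathbf x=\mathbf x^{(N_R)}$ be a transmit vector with entries in $\{\pm\sqrt{E/(2N_T)},\pm j\sqrt{E/(2N_T)}\}$, and let $\mathbf f=\mathbf f^{(N_R)}\in\mathbb C^{N_R}$ be a receive filter. Put $$\mathbf r_0=\sum_{q=1}^Q\gamma_q\mathbf G_q\mathbf x,\qquad \mathbf r_1=\gamma_0\mathbf G_0\mathbf x+\mathbf r_0$$ for the noise-free signal under hypothesis $\mathcal H_0$ (clutter only) and $\mathcal H_1$ (target and clutter), let $\mathbf n_R\sim\mathcal{CN}(\mathbf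 0,\sigma_R^2\mathbf I_{N_R})$, and let $\mathcal Q(w)=\mathrm{sign}(\Re w)+j\,\mathrm{sign}(\Im w)$, applied entrywise. For $i\in\{0,1\}$, conditionally on $\mathcal H_i$ and on the amplitudes, the filter output is $z=\mathbf f^H\mathcal Q(\mathbf r_i+\mathbf n_R)$. Assume that $\mathbf f\neq\mathbf 0$ for all large $N_R$ and that $\max_n|[\mathbf f]_n|/\|\mathbf f\|\to0$ as $N_R\to\infty$ (this holds, for example, if $\max_n|[\mathbf f]_n|\le C\min_n|[\mathbf f]_n|$ with $C$ independent of $N_R$). Then for $i\in\{0,1\}$, as $N_R\to\infty$: 1. the low SNR/CNR property holds at every receive antenna: $\max_n|[\mathbf r_i]_n|^2/\sigma_R^2\to0$; 2. $z$ is asymptotically complex Gaussian with mean $m=\frac{2}{\sqrt{\pi\sigma_R^2}}\,\mathbf f^H\mathbf r_i$ and variance $2\|\mathbf f\|^2$, that is, with the asymptotic density $\frac{1}{2\pi\|\mathbf f\|^2}\exp\!\big(-\frac{|z-m|^2}{2\|\mathbf f\|^2}\big)$: the law of $(z-m)/\sqrt{2\|\mathbf f\|^2}$ converges weakly to $\mathcal{CN}(0,1)$,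 the law with density $\frac1\pi e^{-|w|^2}$ on $\mathbb C$; 3. the mean and the variance of $z$ have these values asymptotically: $(\mathbb E z-m)/\sqrt{2\|\mathbf f\|^2}\to0$ and $\mathbb E|z-\mathbb E z|^2/(2\|\mathbf f\|^2)\to1$. -/

import Mathlib

open MeasureTheory ProbabilityTheory Filter Topology
open scoped NNReal ENNReal

namespace OneBitRadar

/-! ### Circularly symmetric complex Gaussian laws -/

/-- The law `CN(m, v)`: real and imaginary parts are independent real Gaussians with means
`re m`, `im m` and variance `v / 2` each. -/
noncomputable def complexGaussian (m : ℂ) (v : ℝ≥0) : Measure ℂ :=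
  ((gaussianReal m.re (v / 2)).prod (gaussianReal m.im (v / 2))).map
    Complex.measurableEquivRealProd.symm

instance complexGaussian_isProbabilityMeasure (m : ℂ) (v : ℝ≥0) :
    IsProbabilityMeasure (complexGaussian m v) :=
  Measure.isProbabilityMeasure_map Complex.measurableEquivRealProd.symm.measurable.aemeasurable

/-- The probability density of `CN(m, v)` with respect to Lebesgue measure on `ℂ`. -/
noncomputable def complexGaussianPDF (m : ℂ) (v : ℝ≥0) (z : ℂ) : ℝ :=
  1 / (Real.pi * v) * Real.exp (-‖z - m‖ ^ 2 / v)

theorem complexGaussian_eq_withDensity (m : ℂ) {v : ℝ≥0} (hv : v ≠ 0) :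
    complexGaussian m v =
      volume.withDensity (fun z => ENNReal.ofReal (complexGaussianPDF m v z)) := by
  have hv2 : v / 2 ≠ 0 := div_ne_zero hv two_ne_zero
  have hvpos : (0 : ℝ) < v := by exact_mod_cast pos_iff_ne_zero.mpr hv
  rw [complexGaussian, gaussianReal_of_var_ne_zero _ hv2, gaussianReal_of_var_ne_zero _ hv2,
    prod_withDensity (measurable_gaussianPDF _ _) (measurable_gaussianPDF _ _)]
  have key : (fun p : ℝ × ℝ => gaussianPDF m.re (v / 2) p.1 * gaussianPDF m.im (v / 2) p.2)
      = (fun z => ENNReal.ofReal (complexGaussianPDF m v z)) ∘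
        Complex.measurableEquivRealProd.symm := by
    funext p
    simp only [Function.comp, gaussianPDF, gaussianPDFReal, complexGaussianPDF,
      Complex.measurableEquivRealProd_symm_apply]
    rw [← ENNReal.ofReal_mul (by positivity)]
    congr 1
    rw [Complex.sq_norm, Complex.normSq_apply]
    push_cast
    have h1 : (2 * Real.pi * ((v : ℝ) / 2)) = Real.pi * v := by ring
    rw [h1]
    have h2 : (√(Real.pi * v))⁻¹ * (√(Real.pi * v))⁻¹ = 1 / (Real.pi * v) := by
      rw [← mul_inv, Real.mul_self_sqrt (by positivity), one_div]
    rw [mul_mul_mul_comm, h2, ← Real.exp_add]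
    congr 2
    simp
    field_simp
    ring
  ext s hs
  rw [Measure.map_apply Complex.measurableEquivRealProd.symm.measurable hs, key,
    withDensity_apply _ (Complex.measurableEquivRealProd.symm.measurable hs),
    withDensity_apply _ hs, ← Measure.volume_eq_prod]
  exact Complex.volume_preserving_equiv_real_prod.symm.setLIntegral_comp_preimage_emb
    Complex.measurableEquivRealProd.symm.measurableEmbedding
    (fun z => ENNReal.ofReal (complexGaussianPDF m v z)) s

/-- `Z N` is asymptotically complex Gaussian with mean `m N` and variance `v N`: the variances are
eventually positive and `(Z N - m N) / √(v N)` converges in distribution to `CN(0, 1)`. -/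
def IsAsymptoticallyComplexGaussian {Ω : ℕ → Type*} [∀ N, MeasurableSpace (Ω N)]
    (P : ∀ N, Measure (Ω N)) [∀ N, IsProbabilityMeasure (P N)]
    (Z : ∀ N, Ω N → ℂ) (m : ℕ → ℂ) (v : ℕ → ℝ) : Prop :=
  (∀ᶠ N in atTop, 0 < v N) ∧
    TendstoInDistribution (fun N ω => (Z N ω - m N) / (√(v N) : ℂ)) atTop id P
      (complexGaussian 0 1)

/-! ### The radar model -/

/-- The two hypotheses: clutter only, or target and clutter. -/
inductive Hypothesis
  | H0
  | H1

/-- Unit-norm steering vector of a half-wavelength uniform linear array with `N` antennas. -/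
noncomputable def steering (N : ℕ) (θ : ℝ) : Fin N → ℂ := fun k =>
  (1 / √(N : ℝ) : ℝ) * Complex.exp (-(Complex.I * Real.pi * (k : ℕ) * Real.sin θ))

/-- The channel `G(θ) = g_R(θ) g_T(θ)ᵀ`. -/
noncomputable def channel (NR NT : ℕ) (θ : ℝ) : Matrix (Fin NR) (Fin NT) ℂ :=
  Matrix.vecMulVec (steering NR θ) (steering NT θ)

/-- The output alphabet of the 1-bit DACs, for transmit power budget `E`. -/
noncomputable def dacAlphabet (E : ℝ) (NT : ℕ) : Set ℂ :=
  let a : ℂ := (√(E / (2 * NT)) : ℝ)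
  {a, -a, Complex.I * a, -(Complex.I * a)}

/-- Noise-free received signal under each hypothesis: index `0` is the target, the indices
`1, …, Q` are the clutter sources, `θ` holds the angles and `γ` the complex amplitudes. -/
noncomputable def received (Q NR NT : ℕ) (θ : Fin (Q + 1) → ℝ) (γ : Fin (Q + 1) → ℂ)
    (x : Fin NT → ℂ) : Hypothesis → (Fin NR → ℂ)
  | .H0 => ∑ q : Fin Q, γ q.succ • (channel NR NT (θ q.succ)).mulVec x
  | .H1 => γ 0 • (channel NR NT (θ 0)).mulVec x
      + ∑ q : Fin Q, γ q.succ • (channel NR NT (θ q.succ)).mulVec x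

/-- The 1-bit ADC, applied to one complex sample. -/
noncomputable def quantize (w : ℂ) : ℂ := (Real.sign w.re : ℂ) + Complex.I * (Real.sign w.im : ℂ)

/-- The law `CN(0, v I_N)` of white Gaussian noise on `N` antennas. -/
noncomputable def awgn (N : ℕ) (v : ℝ≥0) : Measure (Fin N → ℂ) :=
  Measure.pi fun _ => complexGaussian 0 v

/-- `fᴴ u`. -/
def filterOutput {N : ℕ} (f : EuclideanSpace ℂ (Fin N)) (u : Fin N → ℂ) : ℂ :=
  star f.ofLp ⬝ᵥ u

end OneBitRadar

namespace OneBitRadar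

/-! Steering vectors have entries of modulus `1/√N` and the rest of the scene is fixed, so every
noise-free sample has modulus at most `δ = B/√N`: the one-bit quantizer works in its linear regime.
The output is a sum of independent bounded terms, and within each term the real and imaginary signs
are independent because those parts of the noise are.

For `Y ∼ N(0, v)`, the mean of `sign (a + Y)` is the Gaussian mass of `[-a, a]`, that is `signGain v
* a + O(|a|³)` (`abs_meanSign_sub_le`). Summed against the filter, the cubic errors are `o(‖f‖)`,
which gives the mean. Almost surely a quantized sample has squared modulus 2, so its variance is 2
minus the squared modulus of its mean, itself `O(δ²)`; this gives the variance.

The limit law is a quantitative central limit theorem via characteristic functions. A sign has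
characteristic function `cos u + i p sin u`, with `p` its mean, which is close to that of a Gaussian
with mean `signGain v * a` and variance 1 (`norm_signChar_sub_signGauss_le`). Products are compared
factor by factor (`norm_prod_sub_prod_le`), and the product of the Gaussian factors, once centred,
is exactly the target characteristic function (`cexp_mul_prod_signGauss`). The total error is
controlled, for fixed `t`, by `max |f n| / ‖f‖`, `δ²` and `N δ⁴`, all of which tend to 0; Lévy's
continuity theorem concludes. -/

/-! ### The sign of a shifted centred Gaussian variable -/

theorem measurable_real_sign : Measurable Real.sign := by
  unfold Real.sign
  exact Measurable.ite measurableSet_Iio measurable_const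
    (Measurable.ite measurableSet_Ioi measurable_const measurable_const)

theorem abs_real_sign_le_one (x : ℝ) : |Real.sign x| ≤ 1 := by
  rcases Real.sign_apply_eq x with h | h | h <;> simp [h]

theorem ae_sign_sq_eq_one {v : ℝ≥0} (hv : v ≠ 0) (a : ℝ) :
    ∀ᵐ y ∂gaussianReal 0 v, Real.sign (a + y) ^ 2 = 1 := by
  have := nullSingletonClass_gaussianReal (μ := 0) hv
  filter_upwards [compl_mem_ae_iff.2 (measure_singleton (μ := gaussianReal 0 v) (-a))] with y hy
  have h0 : a + y ≠ 0 := fun h => hy (by simp only [Set.mem_singleton_iff]; linarith)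
  rcases lt_or_gt_of_ne h0 with h | h
  · simp [Real.sign_of_neg h]
  · simp [Real.sign_of_pos h]

/-- The mean of `sign (a + Y)` for `Y ∼ N(0, v)`. -/
noncomputable def meanSign (v : ℝ≥0) (a : ℝ) : ℝ :=
  ∫ y, Real.sign (a + y) ∂gaussianReal 0 v

/-- The slope of `meanSign v` at the origin. -/
noncomputable def signGain (v : ℝ≥0) : ℝ := 2 / √(2 * Real.pi * v)

theorem signGain_nonneg (v : ℝ≥0) : 0 ≤ signGain v := by unfold signGain; positivity

theorem measurable_sign_add (a : ℝ) : Measurable fun y => Real.sign (a + y) :=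
  measurable_real_sign.comp (measurable_const_add a)

theorem abs_meanSign_le_one (v : ℝ≥0) (a : ℝ) : |meanSign v a| ≤ 1 := by
  have := norm_integral_le_of_norm_le_const (μ := gaussianReal 0 v)
    (f := fun y => Real.sign (a + y)) (C := 1) (ae_of_all _ fun y => abs_real_sign_le_one _)
  simpa [meanSign] using this

/-- The mean is the mass to the right of `-a` minus the mass to its left; by symmetry of the density
the former is the mass to the left of `a`. The interval integral is oriented, so negative `a` is
covered. -/
theorem meanSign_eq_intervalIntegral {v : ℝ≥0} (hv : v ≠ 0) (a : ℝ) :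
    meanSign v a = ∫ y in (-a)..a, gaussianPDFReal 0 v y := by
  have hint := integrable_gaussianPDFReal 0 v
  have hint' : Integrable (fun y => gaussianPDFReal 0 v y • Real.sign (a + y)) := by
    refine hint.mono (by
      exact ((measurable_gaussianPDFReal 0 v).mul (measurable_sign_add a)).aestronglyMeasurable)
      (ae_of_all _ fun y => ?_)
    rw [smul_eq_mul, norm_mul]
    exact mul_le_of_le_one_right (norm_nonneg _) (abs_real_sign_le_one _)
  rw [meanSign, integral_gaussianReal_eq_integral_smul hv,
    ← integral_add_compl (s := Set.Iic (-a)) measurableSet_Iic hint', Set.compl_Iic,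
    ← intervalIntegral.integral_Iic_sub_Iic hint.integrableOn hint.integrableOn]
  have h1 : ∫ y in Set.Iic (-a), gaussianPDFReal 0 v y • Real.sign (a + y)
      = -∫ y in Set.Iic (-a), gaussianPDFReal 0 v y := by
    -- The endpoint `-a`, where the sign is 0 rather than -1, is discarded as a null set.
    rw [integral_Iic_eq_integral_Iio, integral_Iic_eq_integral_Iio, ← integral_neg]
    refine setIntegral_congr_fun measurableSet_Iio fun y hy => ?_
    have : a + y < 0 := by have := Set.mem_Iio.1 hy; linarith
    simp [Real.sign_of_neg this]
  have h2 : ∫ y in Set.Ioi (-a), gaussianPDFReal 0 v y • Real.sign (a + y)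
      = ∫ y in Set.Iic a, gaussianPDFReal 0 v y := by
    have h3 : ∫ y in Set.Iic a, gaussianPDFReal 0 v y
        = ∫ y in Set.Iic a, gaussianPDFReal 0 v (-y) := by simp [gaussianPDFReal]
    rw [h3, integral_comp_neg_Iic]
    refine setIntegral_congr_fun measurableSet_Ioi fun y hy => ?_
    have : 0 < a + y := by have := Set.mem_Ioi.1 hy; linarith
    simp [Real.sign_of_pos this]
  rw [h1, h2]; ring

theorem gaussianPDFReal_le_at_mean (v : ℝ≥0) (y : ℝ) :
    gaussianPDFReal 0 v y ≤ signGain v / 2 := by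
  have : Real.exp (-(y - 0) ^ 2 / (2 * v)) ≤ 1 := Real.exp_le_one_iff.2
    (div_nonpos_of_nonpos_of_nonneg (by nlinarith [sq_nonneg (y - 0)]) (by positivity))
  have h := mul_le_of_le_one_right (a := (√(2 * Real.pi * v))⁻¹) (by positivity) this
  rw [gaussianPDFReal, signGain]
  rw [show 2 / √(2 * Real.pi * v) / 2 = (√(2 * Real.pi * v))⁻¹ by ring]
  exact h

theorem abs_gaussianPDFReal_sub_at_mean_le (v : ℝ≥0) (y : ℝ) :
    |gaussianPDFReal 0 v y - signGain v / 2| ≤ signGain v / 2 * (y ^ 2 / (2 * v)) := by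
  rw [abs_sub_comm, abs_of_nonneg (sub_nonneg.2 (gaussianPDFReal_le_at_mean v y))]
  have h := Real.one_sub_le_exp_neg (y ^ 2 / (2 * v))
  have h0 : (0 : ℝ) ≤ (√(2 * Real.pi * v))⁻¹ := by positivity
  have h1 : signGain v / 2 = (√(2 * Real.pi * v))⁻¹ := by rw [signGain]; ring
  rw [h1, gaussianPDFReal, sub_zero, neg_div]
  nlinarith [mul_le_mul_of_nonneg_left h h0]

theorem abs_meanSign_le {v : ℝ≥0} (hv : v ≠ 0) (a : ℝ) :
    |meanSign v a| ≤ signGain v * |a| := by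
  rw [meanSign_eq_intervalIntegral hv]
  rw [← Real.norm_eq_abs]
  refine (intervalIntegral.norm_integral_le_of_norm_le_const (C := signGain v / 2)
    fun y _ => ?_).trans_eq ?_
  · rw [Real.norm_of_nonneg (gaussianPDFReal_nonneg _ _ _)]
    exact gaussianPDFReal_le_at_mean v y
  · rw [sub_neg_eq_add, ← two_mul, abs_mul, abs_two]; ring

/-- The constant in the cubic error of the linear approximation of `meanSign v`. -/
noncomputable def signErr (v : ℝ≥0) : ℝ := signGain v / (2 * v)

theorem signErr_nonneg (v : ℝ≥0) : 0 ≤ signErr v :=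
  div_nonneg (signGain_nonneg v) (by positivity)

/-- The linear term is the integral over `[-a, a]` of the peak density `signGain v / 2`. The density
is flat to first order at its peak, so the integrand of the difference is `O(a²)` on an interval of
length `2|a|`. -/
theorem abs_meanSign_sub_le {v : ℝ≥0} (hv : v ≠ 0) (a : ℝ) :
    |meanSign v a - signGain v * a| ≤ signErr v * |a| ^ 3 := by
  have h : meanSign v a - signGain v * a
      = ∫ y in (-a)..a, (gaussianPDFReal 0 v y - signGain v / 2) := by
    rw [intervalIntegral.integral_sub (integrable_gaussianPDFReal 0 v).intervalIntegrable
      intervalIntegrable_const, ← meanSign_eq_intervalIntegral hv, intervalIntegral.integral_const]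
    simp only [smul_eq_mul]; ring
  rw [h]
  rw [← Real.norm_eq_abs]
  refine (intervalIntegral.norm_integral_le_of_norm_le_const
    (C := signGain v / 2 * (a ^ 2 / (2 * v))) fun y hy => ?_).trans_eq ?_
  · refine (abs_gaussianPDFReal_sub_at_mean_le v y).trans ?_
    have hya : y ^ 2 ≤ a ^ 2 := by
      rw [Set.mem_uIoc] at hy
      rcases hy with hy | hy <;> nlinarith
    have := signGain_nonneg v
    gcongr
  · rw [sub_neg_eq_add, ← two_mul, abs_mul, abs_two, signErr, ← sq_abs a]; ring

/-! ### Characteristic functions of signs -/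

theorem cexp_mul_sign {s : ℝ} (hs : s ^ 2 = 1) (u : ℝ) :
    Complex.exp ((u * s : ℝ) * Complex.I) = Real.cos u + Real.sin u * Complex.I * (s : ℝ) := by
  rcases sq_eq_one_iff.1 hs with h | h <;> subst h <;>
    simp [Complex.exp_mul_I, ← neg_mul]

/-- The characteristic function at `u` of `sign (a + Y)` for `Y ∼ N(0, v)`. -/
noncomputable def signChar (v : ℝ≥0) (a u : ℝ) : ℂ :=
  ∫ y, Complex.exp ((u * Real.sign (a + y) : ℝ) * Complex.I) ∂gaussianReal 0 v

theorem integrable_sign_add (v : ℝ≥0) (a : ℝ) :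
    Integrable (fun y => Real.sign (a + y)) (gaussianReal 0 v) :=
  Integrable.of_bound (measurable_sign_add a).aestronglyMeasurable 1
    (ae_of_all _ fun _ => abs_real_sign_le_one _)

theorem signChar_eq {v : ℝ≥0} (hv : v ≠ 0) (a u : ℝ) :
    signChar v a u = Real.cos u + Real.sin u * Complex.I * (meanSign v a : ℝ) := by
  have h : signChar v a u = ∫ y, ((Real.cos u : ℂ) + Real.sin u * Complex.I *
      (Real.sign (a + y) : ℝ)) ∂gaussianReal 0 v :=
    integral_congr_ae ((ae_sign_sq_eq_one hv a).mono fun y hy => cexp_mul_sign hy u)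
  rw [h, integral_add (integrable_const _) ((integrable_sign_add v a).ofReal.const_mul _),
    integral_const_mul]
  simp [meanSign, integral_complex_ofReal]

theorem norm_signChar_le_one (v : ℝ≥0) (a u : ℝ) : ‖signChar v a u‖ ≤ 1 := by
  have := norm_integral_le_of_norm_le_const (μ := gaussianReal 0 v)
    (f := fun y => Complex.exp ((u * Real.sign (a + y) : ℝ) * Complex.I)) (C := 1)
    (ae_of_all _ fun y => (Complex.norm_exp_ofReal_mul_I _).le)
  simpa [signChar] using this

/-- The Gaussian approximation of `signChar v a u` for small `a` and `u`. -/
noncomputable def signGauss (v : ℝ≥0) (a u : ℝ) : ℂ :=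
  Complex.exp ((u * (signGain v * a) : ℝ) * Complex.I - (u ^ 2 / 2 : ℝ))

theorem norm_signGauss_le_one (v : ℝ≥0) (a u : ℝ) : ‖signGauss v a u‖ ≤ 1 := by
  rw [signGauss, Complex.norm_exp]
  simp only [Complex.sub_re, Complex.re_ofReal_mul, Complex.I_re, mul_zero, Complex.ofReal_re,
    zero_sub]
  exact Real.exp_le_one_iff.2 (by nlinarith [sq_nonneg u])

theorem abs_sin_sub_self_le {u : ℝ} (hu : |u| ≤ 1) : |Real.sin u - u| ≤ |u| ^ 3 := by
  have h := Real.sin_bound hu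
  have h5 : |u| ^ 5 ≤ |u| ^ 3 := pow_le_pow_of_le_one (abs_nonneg u) hu (by norm_num)
  have h3 : |u ^ 3 / 6| = |u| ^ 3 / 6 := by rw [abs_div, abs_pow]; norm_num
  have : Real.sin u - u = (Real.sin u - (u - u ^ 3 / 6)) - u ^ 3 / 6 := by ring
  rw [this]
  refine (abs_sub _ _).trans ?_
  rw [h3]
  have := pow_nonneg (abs_nonneg u) 3
  linarith

/-- The form of the bound is dictated by the later sum over antennas: the `u²` sum to a constant, so
each term must carry either `u²` times something small or `a⁴`. -/
theorem norm_signChar_sub_signGauss_le {v : ℝ≥0} (hv : v ≠ 0) {a u : ℝ} (hu : |u| ≤ 1)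
    (ha : signGain v * |a| ≤ 1 / 2) :
    ‖signChar v a u - signGauss v a u‖
      ≤ 3 * |u| ^ 3 + signErr v * (a ^ 4 + a ^ 2 * u ^ 2) + signGain v ^ 2 * a ^ 2 * u ^ 2 := by
  set c := signGain v
  set p := meanSign v a
  have hc : 0 ≤ c := signGain_nonneg v
  have hu0 := abs_nonneg u
  have ha0 := abs_nonneg a
  have hu4 : |u| ^ 4 ≤ |u| ^ 3 := pow_le_pow_of_le_one hu0 hu (by norm_num)
  have hu3 : 0 ≤ |u| ^ 3 := by positivity
  set w : ℂ := (u * (c * a) : ℝ) * Complex.I - (u ^ 2 / 2 : ℝ) with hw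
  have hwsq : ‖w‖ ^ 2 = (u * (c * a)) ^ 2 + (u ^ 2 / 2) ^ 2 := by
    rw [Complex.sq_norm, Complex.normSq_apply]
    simp only [hw, Complex.sub_re, Complex.sub_im, Complex.re_ofReal_mul, Complex.im_ofReal_mul,
      Complex.I_re, Complex.I_im, Complex.ofReal_re, Complex.ofReal_im]
    ring
  have hb : (c * |a|) ^ 2 ≤ 1 / 4 := by
    have : 0 ≤ c * |a| := by positivity
    nlinarith
  have husq : u ^ 2 ≤ 1 := by rw [← sq_abs]; exact pow_le_one₀ hu0 hu
  -- The two smallness hypotheses serve to bring the exponent into the unit disc, where the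
  -- exponential has a quadratic Taylor remainder.
  have hw1 : ‖w‖ ≤ 1 := by
    have : ‖w‖ ^ 2 ≤ 1 := by
      rw [hwsq]
      have h1 : (u * (c * a)) ^ 2 = u ^ 2 * (c * |a|) ^ 2 := by
        rw [mul_pow, mul_pow, mul_pow, sq_abs]
      rw [h1]
      nlinarith [sq_nonneg u, sq_nonneg (c * |a|)]
    exact (sq_le_one_iff₀ (norm_nonneg _)).1 this
  have hexp := Complex.norm_exp_sub_one_sub_id_le hw1
  -- Both sides expand as `1 - u²/2 + i u c a`; what is left is the cosine, sine, mean and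
  -- exponential remainders. The `|u|³` contributions are 1/2, 1 and 1, whence the constant 3.
  have hdecomp : signChar v a u - signGauss v a u
      = (Real.cos u - (1 - u ^ 2 / 2) : ℝ) + ((Real.sin u - u) * p + u * (p - c * a) : ℝ) * Complex.I
        - (Complex.exp w - 1 - w) := by
    rw [signChar_eq hv, signGauss]
    simp only [hw]
    push_cast
    ring
  have h1 : |Real.cos u - (1 - u ^ 2 / 2)| ≤ |u| ^ 3 / 2 := by
    refine (Real.cos_bound hu).trans ?_
    linarith
  have h2 : |(Real.sin u - u) * p + u * (p - c * a)|
      ≤ |u| ^ 3 + signErr v * (a ^ 4 + a ^ 2 * u ^ 2) := by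
    refine (abs_add_le _ _).trans (add_le_add ?_ ?_)
    · rw [abs_mul]
      exact (mul_le_of_le_one_right (abs_nonneg _) (abs_meanSign_le_one v a)).trans
        (abs_sin_sub_self_le hu)
    · rw [abs_mul]
      have hk := signErr_nonneg v
      refine (mul_le_mul_of_nonneg_left (abs_meanSign_sub_le hv a) hu0).trans ?_
      -- AM-GM on `|u| |a|`, after factoring out `a²`.
      have h3 : |u| * |a| ^ 3 ≤ a ^ 4 + a ^ 2 * u ^ 2 := by
        have e1 : a ^ 4 = |a| ^ 2 * |a| ^ 2 := by rw [sq_abs]; ring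
        have e2 : a ^ 2 * u ^ 2 = |a| ^ 2 * |u| ^ 2 := by rw [sq_abs, sq_abs]
        rw [e1, e2]
        nlinarith [mul_nonneg (sq_nonneg |a|) (sq_nonneg (|u| - |a|)),
          mul_nonneg (sq_nonneg |a|) (add_nonneg (sq_nonneg |u|) (sq_nonneg |a|))]
      nlinarith [mul_le_mul_of_nonneg_left h3 hk]
  have h3 : ‖w‖ ^ 2 ≤ c ^ 2 * a ^ 2 * u ^ 2 + |u| ^ 3 := by
    rw [hwsq]
    have : u ^ 4 = |u| ^ 4 := by rw [← abs_pow, abs_of_nonneg (by positivity)]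
    nlinarith
  rw [hdecomp]
  refine (norm_sub_le _ _).trans ((add_le_add (norm_add_le _ _) hexp).trans ?_)
  rw [norm_mul, Complex.norm_I, mul_one, Complex.norm_real, Complex.norm_real, Real.norm_eq_abs,
    Real.norm_eq_abs]
  linarith

/-- Telescoping: factors are exchanged one at a time, and the others have norm at most 1. -/
theorem norm_prod_sub_prod_le {ι R : Type*} [NormedCommRing R] [NormOneClass R] (s : Finset ι)
    (f g : ι → R) (hf : ∀ i, ‖f i‖ ≤ 1) (hg : ∀ i, ‖g i‖ ≤ 1) :
    ‖∏ i ∈ s, f i - ∏ i ∈ s, g i‖ ≤ ∑ i ∈ s, ‖f i - g i‖ := by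
  classical
  induction s using Finset.induction_on with
  | empty => simp
  | insert i s hi ih =>
    rw [Finset.prod_insert hi, Finset.prod_insert hi, Finset.sum_insert hi,
      show f i * ∏ j ∈ s, f j - g i * ∏ j ∈ s, g j
        = (f i - g i) * ∏ j ∈ s, f j + g i * (∏ j ∈ s, f j - ∏ j ∈ s, g j) by ring]
    refine (norm_add_le _ _).trans (add_le_add ?_ ?_)
    · refine (norm_mul_le _ _).trans (mul_le_of_le_one_right (norm_nonneg _) ?_)
      exact (Finset.norm_prod_le s f).trans
        (Finset.prod_le_one (fun _ _ => norm_nonneg _) fun j _ => hf j)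
    · exact (norm_mul_le _ _).trans
        ((mul_le_of_le_one_left (norm_nonneg _) (hg i)).trans ih)

/-! ### Centred complex Gaussian laws -/

theorem integral_complexGaussian_mul (v : ℝ≥0) (g h : ℝ → ℂ) :
    ∫ y, g y.re * h y.im ∂complexGaussian 0 v
      = (∫ y, g y ∂gaussianReal 0 (v / 2)) * ∫ y, h y ∂gaussianReal 0 (v / 2) := by
  rw [complexGaussian, integral_map_equiv]
  exact integral_prod_mul g h

theorem hasLaw_re_complexGaussian (v : ℝ≥0) :
    HasLaw Complex.re (gaussianReal 0 (v / 2)) (complexGaussian 0 v) where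
  aemeasurable := Complex.measurable_re.aemeasurable
  map_eq := by
    rw [complexGaussian, Measure.map_map Complex.measurable_re (MeasurableEquiv.measurable _)]
    exact Measure.map_fst_prod.trans (by simp)

theorem hasLaw_im_complexGaussian (v : ℝ≥0) :
    HasLaw Complex.im (gaussianReal 0 (v / 2)) (complexGaussian 0 v) where
  aemeasurable := Complex.measurable_im.aemeasurable
  map_eq := by
    rw [complexGaussian, Measure.map_map Complex.measurable_im (MeasurableEquiv.measurable _)]
    exact Measure.map_snd_prod.trans (by simp)

theorem charFun_complexGaussian (v : ℝ≥0) (t : ℂ) :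
    charFun (complexGaussian 0 v) t = Complex.exp (-(v * ‖t‖ ^ 2 / 4 : ℝ)) := by
  have h : charFun (complexGaussian 0 v) t = ∫ y : ℂ, Complex.exp (t.re * y.re * Complex.I) *
      Complex.exp (t.im * y.im * Complex.I) ∂complexGaussian 0 v := by
    rw [charFun_apply]
    congr 1 with y
    rw [← Complex.exp_add, Complex.inner]
    congr 1
    simp
    ring
  rw [h, integral_complexGaussian_mul v (fun y => Complex.exp (t.re * y * Complex.I))
    (fun y => Complex.exp (t.im * y * Complex.I)), ← charFun_apply_real, ← charFun_apply_real,
    charFun_gaussianReal, charFun_gaussianReal, ← Complex.exp_add]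
  congr 1
  rw [Complex.sq_norm, Complex.normSq_apply]
  push_cast
  ring

/-! ### One quantized sample -/

theorem measurable_quantize : Measurable quantize := by
  unfold quantize
  exact (Complex.measurable_ofReal.comp (measurable_real_sign.comp Complex.measurable_re)).add
    ((Complex.measurable_ofReal.comp
      (measurable_real_sign.comp Complex.measurable_im)).const_mul _)

theorem quantize_re (w : ℂ) : (quantize w).re = Real.sign w.re := by simp [quantize]

theorem quantize_im (w : ℂ) : (quantize w).im = Real.sign w.im := by simp [quantize]

theorem norm_quantize_le (w : ℂ) : ‖quantize w‖ ≤ 2 := by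
  refine (Complex.norm_le_abs_re_add_abs_im _).trans ?_
  rw [quantize_re, quantize_im]
  linarith [abs_real_sign_le_one w.re, abs_real_sign_le_one w.im]

/-- The mean of `quantize (a + Y)` for `Y ∼ CN(0, v)`. -/
noncomputable def quantMean (v : ℝ≥0) (a : ℂ) : ℂ :=
  ∫ y, quantize (a + y) ∂complexGaussian 0 v

theorem measurable_quantize_add (a : ℂ) : Measurable fun y => quantize (a + y) :=
  measurable_quantize.comp (measurable_const_add a)

theorem memLp_quantize_add (v : ℝ≥0) (a : ℂ) (p : ℝ≥0∞) :
    MemLp (fun y => quantize (a + y)) p (complexGaussian 0 v) :=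
  MemLp.of_bound (measurable_quantize_add a).aestronglyMeasurable 2
    (ae_of_all _ fun _ => norm_quantize_le _)

theorem quantMean_re (v : ℝ≥0) (a : ℂ) : (quantMean v a).re = meanSign (v / 2) a.re := by
  have hi := (memLp_quantize_add v a 1).integrable le_rfl
  rw [quantMean, ← RCLike.re_eq_complex_re, ← integral_re hi]
  simp only [RCLike.re_eq_complex_re, quantize_re, Complex.add_re]
  exact (hasLaw_re_complexGaussian v).integral_comp (f := fun y => Real.sign (a.re + y))
    (measurable_sign_add _).aestronglyMeasurable

theorem quantMean_im (v : ℝ≥0) (a : ℂ) : (quantMean v a).im = meanSign (v / 2) a.im := by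
  have hi := (memLp_quantize_add v a 1).integrable le_rfl
  rw [quantMean, ← RCLike.im_eq_complex_im, ← integral_im hi]
  simp only [RCLike.im_eq_complex_im, quantize_im, Complex.add_im]
  exact (hasLaw_im_complexGaussian v).integral_comp (f := fun y => Real.sign (a.im + y))
    (measurable_sign_add _).aestronglyMeasurable

theorem norm_quantMean_le {v : ℝ≥0} (hv : v ≠ 0) (a : ℂ) :
    ‖quantMean v a‖ ≤ 2 * signGain (v / 2) * ‖a‖ := by
  have hv2 : v / 2 ≠ 0 := div_ne_zero hv two_ne_zero
  have hg := signGain_nonneg (v / 2)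
  refine (Complex.norm_le_abs_re_add_abs_im _).trans ?_
  rw [quantMean_re, quantMean_im]
  have h1 := abs_meanSign_le hv2 a.re
  have h2 := abs_meanSign_le hv2 a.im
  nlinarith [mul_le_mul_of_nonneg_left (Complex.abs_re_le_norm a) hg,
    mul_le_mul_of_nonneg_left (Complex.abs_im_le_norm a) hg]

theorem norm_quantMean_sub_le {v : ℝ≥0} (hv : v ≠ 0) (a : ℂ) :
    ‖quantMean v a - signGain (v / 2) * a‖ ≤ 2 * signErr (v / 2) * ‖a‖ ^ 3 := by
  have hv2 : v / 2 ≠ 0 := div_ne_zero hv two_ne_zero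
  have hk := signErr_nonneg (v / 2)
  refine (Complex.norm_le_abs_re_add_abs_im _).trans ?_
  rw [Complex.sub_re, Complex.sub_im, Complex.re_ofReal_mul, Complex.im_ofReal_mul,
    quantMean_re, quantMean_im]
  have h1 := abs_meanSign_sub_le hv2 a.re
  have h2 := abs_meanSign_sub_le hv2 a.im
  have h3 := pow_le_pow_left₀ (abs_nonneg _) (Complex.abs_re_le_norm a) 3
  have h4 := pow_le_pow_left₀ (abs_nonneg _) (Complex.abs_im_le_norm a) 3
  nlinarith [mul_le_mul_of_nonneg_left h3 hk, mul_le_mul_of_nonneg_left h4 hk]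

theorem ae_norm_quantize_sq {v : ℝ≥0} (hv : v ≠ 0) (a : ℂ) :
    ∀ᵐ y ∂complexGaussian 0 v, ‖quantize (a + y)‖ ^ 2 = 2 := by
  have hv2 : v / 2 ≠ 0 := div_ne_zero hv two_ne_zero
  have h1 := ae_of_ae_map (hasLaw_re_complexGaussian v).aemeasurable
    ((hasLaw_re_complexGaussian v).map_eq ▸ ae_sign_sq_eq_one hv2 a.re)
  have h2 := ae_of_ae_map (hasLaw_im_complexGaussian v).aemeasurable
    ((hasLaw_im_complexGaussian v).map_eq ▸ ae_sign_sq_eq_one hv2 a.im)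
  filter_upwards [h1, h2] with y hy1 hy2
  rw [Complex.sq_norm, Complex.normSq_apply, quantize_re, quantize_im, ← sq, ← sq,
    Complex.add_re, Complex.add_im, hy1, hy2]
  norm_num

/-! ### Complex variances -/

/-- Reduces complex variances to real ones, for which additivity under independence applies. -/
theorem integral_norm_sub_integral_sq {Ω : Type*} [MeasurableSpace Ω] {P : Measure Ω}
    [IsProbabilityMeasure P] {Z : Ω → ℂ} (hZ : MemLp Z 2 P) :
    ∫ ω, ‖Z ω - ∫ ω', Z ω' ∂P‖ ^ 2 ∂P
      = Var[fun ω => (Z ω).re; P] + Var[fun ω => (Z ω).im; P] := by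
  have hi := hZ.integrable (by norm_num)
  have hre : MemLp (fun ω => (Z ω).re) 2 P := hZ.re
  have him : MemLp (fun ω => (Z ω).im) 2 P := hZ.im
  have h1 : (∫ ω, Z ω ∂P).re = ∫ ω, (Z ω).re ∂P := (integral_re hi).symm
  have h2 : (∫ ω, Z ω ∂P).im = ∫ ω, (Z ω).im ∂P := (integral_im hi).symm
  have i1 : Integrable (fun ω => ((Z ω).re - ∫ ω', (Z ω').re ∂P) ^ 2) P :=
    (hre.sub (memLp_const _)).integrable_sq
  have i2 : Integrable (fun ω => ((Z ω).im - ∫ ω', (Z ω').im ∂P) ^ 2) P :=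
    (him.sub (memLp_const _)).integrable_sq
  rw [variance_eq_integral hre.aemeasurable, variance_eq_integral him.aemeasurable,
    ← integral_add i1 i2]
  congr 1 with ω
  rw [Complex.sq_norm, Complex.normSq_apply, Complex.sub_re, Complex.sub_im, h1, h2]
  ring

theorem integral_norm_sub_integral_sq_eq_sub {Ω : Type*} [MeasurableSpace Ω] {P : Measure Ω}
    [IsProbabilityMeasure P] {Z : Ω → ℂ} (hZ : MemLp Z 2 P) :
    ∫ ω, ‖Z ω - ∫ ω', Z ω' ∂P‖ ^ 2 ∂P = ∫ ω, ‖Z ω‖ ^ 2 ∂P - ‖∫ ω, Z ω ∂P‖ ^ 2 := by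
  have hi := hZ.integrable (by norm_num)
  have hre : MemLp (fun ω => (Z ω).re) 2 P := hZ.re
  have him : MemLp (fun ω => (Z ω).im) 2 P := hZ.im
  have h1 : (∫ ω, Z ω ∂P).re = ∫ ω, (Z ω).re ∂P := (integral_re hi).symm
  have h2 : (∫ ω, Z ω ∂P).im = ∫ ω, (Z ω).im ∂P := (integral_im hi).symm
  have h3 : ∫ ω, ‖Z ω‖ ^ 2 ∂P = ∫ ω, (Z ω).re ^ 2 ∂P + ∫ ω, (Z ω).im ^ 2 ∂P := by
    rw [← integral_add hre.integrable_sq him.integrable_sq]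
    congr 1 with ω
    rw [Complex.sq_norm, Complex.normSq_apply]; ring
  rw [integral_norm_sub_integral_sq hZ, variance_eq_sub hre, variance_eq_sub him, h3,
    Complex.sq_norm, Complex.normSq_apply, h1, h2]
  simp only [Pi.pow_apply]
  ring

theorem integral_norm_sum_pi_sub_sq {ι : Type*} [Fintype ι] {Ω : ι → Type*}
    {mΩ : ∀ i, MeasurableSpace (Ω i)} {μ : ∀ i, Measure (Ω i)} [∀ i, IsProbabilityMeasure (μ i)]
    {X : ∀ i, Ω i → ℂ} (hX : ∀ i, MemLp (X i) 2 (μ i)) :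
    ∫ ω, ‖∑ i, X i (ω i) - ∫ ω', ∑ i, X i (ω' i) ∂Measure.pi μ‖ ^ 2 ∂Measure.pi μ
      = ∑ i, (∫ y, ‖X i y‖ ^ 2 ∂μ i - ‖∫ y, X i y ∂μ i‖ ^ 2) := by
  have hmem : MemLp (fun ω => ∑ i, X i (ω i)) 2 (Measure.pi μ) :=
    memLp_finsetSum _ fun i _ => (hX i).comp_measurePreserving (measurePreserving_eval μ i)
  rw [integral_norm_sub_integral_sq hmem]
  have hr := variance_sum_pi (X := fun i y => (X i y).re) (μ := μ) fun i => (hX i).re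
  have hj := variance_sum_pi (X := fun i y => (X i y).im) (μ := μ) fun i => (hX i).im
  have er : (fun ω : ∀ i, Ω i => (∑ i, X i (ω i)).re) = ∑ i, fun ω => (X i (ω i)).re := by
    ext ω; simp
  have ej : (fun ω : ∀ i, Ω i => (∑ i, X i (ω i)).im) = ∑ i, fun ω => (X i (ω i)).im := by
    ext ω; simp
  rw [er, ej, hr, hj, ← Finset.sum_add_distrib]
  exact Finset.sum_congr rfl fun i _ => by
    rw [← integral_norm_sub_integral_sq (hX i), integral_norm_sub_integral_sq_eq_sub (hX i)]

/-! ### The filter output for a fixed number of antennas -/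

theorem filterOutput_eq_sum {N : ℕ} (f : EuclideanSpace ℂ (Fin N)) (u : Fin N → ℂ) :
    filterOutput f u = ∑ n, star (f n) * u n := rfl

instance awgn_isProbabilityMeasure (N : ℕ) (v : ℝ≥0) : IsProbabilityMeasure (awgn N v) := by
  unfold awgn; infer_instance

/-- The filter output as a function of the noise. -/
noncomputable def quantOutput {N : ℕ} (f : EuclideanSpace ℂ (Fin N)) (r y : Fin N → ℂ) : ℂ :=
  filterOutput f (fun n => quantize (r n + y n))

theorem measurable_quantOutput {N : ℕ} (f : EuclideanSpace ℂ (Fin N)) (r : Fin N → ℂ) :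
    Measurable (quantOutput f r) := by
  unfold quantOutput
  simp only [filterOutput_eq_sum]
  exact Finset.measurable_fun_sum _ fun n _ =>
    ((measurable_quantize_add (r n)).comp (measurable_pi_apply n)).const_mul _

theorem memLp_star_mul_quantize (v : ℝ≥0) (c a : ℂ) (p : ℝ≥0∞) :
    MemLp (fun y => star c * quantize (a + y)) p (complexGaussian 0 v) :=
  (memLp_quantize_add v a p).const_mul _

theorem integral_quantOutput {N : ℕ} (f : EuclideanSpace ℂ (Fin N)) (r : Fin N → ℂ) (v : ℝ≥0) :
    ∫ y, quantOutput f r y ∂awgn N v = ∑ n, star (f n) * quantMean v (r n) := by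
  simp only [quantOutput, filterOutput_eq_sum]
  have h (n : Fin N) : MemLp (fun y : Fin N → ℂ => star (f n) * quantize (r n + y n)) 1
      (awgn N v) :=
    (memLp_star_mul_quantize v (f n) (r n) 1).comp_measurePreserving (measurePreserving_eval _ n)
  rw [integral_finsetSum _ fun n _ => (h n).integrable le_rfl]
  refine Finset.sum_congr rfl fun n _ => ?_
  rw [integral_const_mul]
  congr 1
  exact integral_comp_eval (μ := fun _ : Fin N => complexGaussian 0 v)
    (f := fun y => quantize (r n + y)) (measurable_quantize_add _).aestronglyMeasurable

theorem integral_norm_quantOutput_sub_sq {N : ℕ} (f : EuclideanSpace ℂ (Fin N)) (r : Fin N → ℂ)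
    {v : ℝ≥0} (hv : v ≠ 0) :
    ∫ y, ‖quantOutput f r y - ∫ y', quantOutput f r y' ∂awgn N v‖ ^ 2 ∂awgn N v
      = ∑ n, ‖f n‖ ^ 2 * (2 - ‖quantMean v (r n)‖ ^ 2) := by
  have h := integral_norm_sum_pi_sub_sq (μ := fun _ : Fin N => complexGaussian 0 v)
    (X := fun n y => star (f n) * quantize (r n + y)) fun n =>
      memLp_star_mul_quantize v (f n) (r n) 2
  simp only [quantOutput, filterOutput_eq_sum]
  refine h.trans (Finset.sum_congr rfl fun n _ => ?_)
  simp only [norm_mul, mul_pow, norm_star, integral_const_mul]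
  rw [integral_congr_ae (ae_norm_quantize_sq hv (r n))]
  simp [quantMean]
  ring

theorem norm_integral_quantOutput_sub_le {N : ℕ} (f : EuclideanSpace ℂ (Fin N)) (r : Fin N → ℂ)
    {v : ℝ≥0} (hv : v ≠ 0) {δ : ℝ} (hr : ∀ n, ‖r n‖ ≤ δ) :
    ‖∫ y, quantOutput f r y ∂awgn N v - signGain (v / 2) * filterOutput f r‖
      ≤ 2 * signErr (v / 2) * ((δ ^ 2 + N * δ ^ 4) * ‖f‖) := by
  have hk := signErr_nonneg (v / 2)
  rcases eq_or_ne f 0 with rfl | hf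
  · simp [integral_quantOutput, filterOutput_eq_sum]
  have hfpos : 0 < ‖f‖ := norm_pos_iff.2 hf
  have hsum : ∑ n, ‖f n‖ ^ 2 = ‖f‖ ^ 2 := (EuclideanSpace.norm_sq_eq f).symm
  -- AM-GM in place of Cauchy–Schwarz: `|f n| δ` is split with weight `‖f‖`, so that both resulting
  -- sums are multiples of `‖f‖`.
  have hterm (n : Fin N) : ‖f n‖ * ‖r n‖ ^ 3 ≤ (δ ^ 2 * ‖f n‖ ^ 2 / ‖f‖ + δ ^ 4 * ‖f‖) := by
    have hδ : 0 ≤ δ := (norm_nonneg _).trans (hr n)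
    have h1 : ‖f n‖ * ‖r n‖ ^ 3 ≤ ‖f n‖ * δ ^ 3 := by gcongr; exact hr n
    refine h1.trans ?_
    rw [div_add' _ _ _ hfpos.ne', le_div_iff₀ hfpos]
    nlinarith [mul_nonneg (sq_nonneg δ) (sq_nonneg (‖f n‖ - δ * ‖f‖)),
      mul_nonneg (sq_nonneg δ) (sq_nonneg (‖f n‖)),
      mul_nonneg (sq_nonneg δ) (sq_nonneg (δ * ‖f‖))]
  rw [integral_quantOutput, filterOutput_eq_sum, Finset.mul_sum, ← Finset.sum_sub_distrib]
  calc ‖∑ n, (star (f n) * quantMean v (r n) - signGain (v / 2) * (star (f n) * r n))‖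
      ≤ ∑ n, 2 * signErr (v / 2) * (‖f n‖ * ‖r n‖ ^ 3) := by
        refine norm_sum_le_of_le _ fun n _ => ?_
        rw [show star (f n) * quantMean v (r n) - signGain (v / 2) * (star (f n) * r n)
          = star (f n) * (quantMean v (r n) - signGain (v / 2) * r n) by ring, norm_mul, norm_star]
        nlinarith [mul_le_mul_of_nonneg_left (norm_quantMean_sub_le hv (r n)) (norm_nonneg (f n))]
    _ ≤ ∑ n, 2 * signErr (v / 2) * (δ ^ 2 * ‖f n‖ ^ 2 / ‖f‖ + δ ^ 4 * ‖f‖) := by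
        gcongr with n; exact hterm n
    _ = 2 * signErr (v / 2) * ((δ ^ 2 + N * δ ^ 4) * ‖f‖) := by
        rw [← Finset.mul_sum, Finset.sum_add_distrib, ← Finset.sum_div, ← Finset.mul_sum, hsum]
        simp only [Finset.sum_const, Finset.card_univ, Fintype.card_fin, nsmul_eq_mul]
        field_simp

theorem abs_integral_norm_quantOutput_sub_sq_sub_le {N : ℕ} (f : EuclideanSpace ℂ (Fin N))
    (r : Fin N → ℂ) {v : ℝ≥0} (hv : v ≠ 0) {δ : ℝ} (hr : ∀ n, ‖r n‖ ≤ δ) :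
    |∫ y, ‖quantOutput f r y - ∫ y', quantOutput f r y' ∂awgn N v‖ ^ 2 ∂awgn N v - 2 * ‖f‖ ^ 2|
      ≤ (2 * signGain (v / 2) * δ) ^ 2 * ‖f‖ ^ 2 := by
  have hg := signGain_nonneg (v / 2)
  have hsum : ∑ n, ‖f n‖ ^ 2 = ‖f‖ ^ 2 := (EuclideanSpace.norm_sq_eq f).symm
  rw [integral_norm_quantOutput_sub_sq f r hv, ← hsum, Finset.mul_sum, Finset.mul_sum,
    ← Finset.sum_sub_distrib, ← Real.norm_eq_abs]
  refine norm_sum_le_of_le _ fun n _ => ?_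
  rw [show ‖f n‖ ^ 2 * (2 - ‖quantMean v (r n)‖ ^ 2) - 2 * ‖f n‖ ^ 2
    = -(‖quantMean v (r n)‖ ^ 2 * ‖f n‖ ^ 2) by ring, norm_neg, Real.norm_of_nonneg (by positivity)]
  have h : ‖quantMean v (r n)‖ ≤ 2 * signGain (v / 2) * δ :=
    (norm_quantMean_le hv _).trans (mul_le_mul_of_nonneg_left (hr n) (by positivity))
  gcongr

/-- The real inner product with `t` is a real linear combination of the `2N` independent signs, so
the expectation factorises. The minus sign comes from the real part of a complex product. -/
theorem charFun_map_quantOutput {N : ℕ} (f : EuclideanSpace ℂ (Fin N)) (r : Fin N → ℂ) (v : ℝ≥0)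
    (m t : ℂ) (s : ℝ) :
    charFun ((awgn N v).map fun y => (quantOutput f r y - m) / (s : ℂ)) t
      = Complex.exp (-((inner ℝ (m / s) t : ℝ) * Complex.I)) *
        ∏ n, (signChar (v / 2) (r n).re (star (f n) * star t / s).re *
          signChar (v / 2) (r n).im (-(star (f n) * star t / s).im)) := by
  have hmeas : Measurable fun y => (quantOutput f r y - m) / (s : ℂ) :=
    ((measurable_quantOutput f r).sub_const m).div_const _
  set w : Fin N → ℂ := fun n => star (f n) * star t / s with hw
  rw [charFun_apply, integral_map hmeas.aemeasurable (by fun_prop)]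
  have hinner (y : Fin N → ℂ) : inner ℝ ((quantOutput f r y - m) / (s : ℂ)) t
      = -inner ℝ (m / s) t + ∑ n, ((w n).re * Real.sign ((r n).re + (y n).re)
        + -(w n).im * Real.sign ((r n).im + (y n).im)) := by
    have h1 : inner ℝ ((quantOutput f r y) / (s : ℂ)) t
        = ∑ n, ((w n).re * Real.sign ((r n).re + (y n).re)
          + -(w n).im * Real.sign ((r n).im + (y n).im)) := by
      rw [real_inner_comm, Complex.inner, quantOutput, filterOutput_eq_sum]
      rw [show ((∑ n, star (f n) * quantize (r n + y n)) / (s : ℂ)) * (starRingEnd ℂ) t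
        = ∑ n, w n * quantize (r n + y n) by
          rw [Finset.sum_div, Finset.sum_mul]
          refine Finset.sum_congr rfl fun n _ => ?_
          rw [hw, starRingEnd_apply]; ring, Complex.re_sum]
      refine Finset.sum_congr rfl fun n _ => ?_
      rw [Complex.mul_re, quantize_re, quantize_im, Complex.add_re, Complex.add_im]
      ring
    rw [sub_div, inner_sub_left, h1]; ring
  simp only [hinner]
  have hexp (y : Fin N → ℂ) : Complex.exp ((-inner ℝ (m / s) t + ∑ n,
        ((w n).re * Real.sign ((r n).re + (y n).re)
        + -(w n).im * Real.sign ((r n).im + (y n).im)) : ℝ) * Complex.I)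
      = Complex.exp (-((inner ℝ (m / s) t : ℝ) * Complex.I)) *
        ∏ n, (Complex.exp (((w n).re * Real.sign ((r n).re + (y n).re) : ℝ) * Complex.I) *
          Complex.exp ((-(w n).im * Real.sign ((r n).im + (y n).im) : ℝ) * Complex.I)) := by
    simp only [← Complex.exp_add]
    rw [← Complex.exp_sum, ← Complex.exp_add]
    congr 1
    push_cast
    rw [add_mul, Finset.sum_mul, neg_mul]
    congr 1
    exact Finset.sum_congr rfl fun n _ => by ring
  simp only [hexp]
  rw [integral_const_mul, awgn]
  congr 1
  rw [integral_fintype_prod_eq_prod (μ := fun _ : Fin N => complexGaussian 0 v) (fun n y =>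
    Complex.exp (((w n).re * Real.sign ((r n).re + y.re) : ℝ) * Complex.I) *
      Complex.exp ((-(w n).im * Real.sign ((r n).im + y.im) : ℝ) * Complex.I))]
  refine Finset.prod_congr rfl fun n _ => ?_
  exact integral_complexGaussian_mul v
    (fun y => Complex.exp (((w n).re * Real.sign ((r n).re + y) : ℝ) * Complex.I))
    (fun y => Complex.exp ((-(w n).im * Real.sign ((r n).im + y) : ℝ) * Complex.I))

theorem norm_signChar_mul_sub_signGauss_mul_le {v : ℝ≥0} (hv : v ≠ 0) {a w : ℂ} {η δ : ℝ}
    (hη : η ≤ 1) (hw : ‖w‖ ≤ η) (ha : ‖a‖ ≤ δ) (hδ : signGain v * δ ≤ 1 / 2) :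
    ‖signChar v a.re w.re * signChar v a.im (-w.im)
        - signGauss v a.re w.re * signGauss v a.im (-w.im)‖
      ≤ (3 * η + (signErr v + signGain v ^ 2) * δ ^ 2) * ‖w‖ ^ 2 + 2 * signErr v * δ ^ 4 := by
  have hg := signGain_nonneg v
  have hk := signErr_nonneg v
  have hδ0 : 0 ≤ δ := (norm_nonneg _).trans ha
  have key {b u : ℝ} (hb : |b| ≤ δ) (hu : |u| ≤ η) : ‖signChar v b u - signGauss v b u‖
      ≤ (3 * η + (signErr v + signGain v ^ 2) * δ ^ 2) * u ^ 2 + signErr v * δ ^ 4 := by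
    refine (norm_signChar_sub_signGauss_le hv (hu.trans hη)
      ((mul_le_mul_of_nonneg_left hb hg).trans hδ)).trans ?_
    have hb2 : b ^ 2 ≤ δ ^ 2 := by rw [← sq_abs]; gcongr
    have hb4 : b ^ 4 ≤ δ ^ 4 := by
      rw [← abs_of_nonneg (by positivity : (0 : ℝ) ≤ b ^ 4), abs_pow]; gcongr
    have hu3 : |u| ^ 3 ≤ η * u ^ 2 := by
      rw [← sq_abs u, pow_succ']; gcongr
    have h1 : signErr v * (b ^ 4 + b ^ 2 * u ^ 2) ≤ signErr v * (δ ^ 4 + δ ^ 2 * u ^ 2) := by gcongr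
    have h2 : signGain v ^ 2 * b ^ 2 * u ^ 2 ≤ signGain v ^ 2 * δ ^ 2 * u ^ 2 := by gcongr
    linarith
  have h1 := key ((Complex.abs_re_le_norm a).trans ha) ((Complex.abs_re_le_norm w).trans hw)
  have h2 := key ((Complex.abs_im_le_norm a).trans ha) (u := -w.im)
    (by rw [abs_neg]; exact (Complex.abs_im_le_norm w).trans hw)
  have hsq : ‖w‖ ^ 2 = w.re ^ 2 + (-w.im) ^ 2 := by
    rw [Complex.sq_norm, Complex.normSq_apply]; ring
  have htri : ‖signChar v a.re w.re * signChar v a.im (-w.im)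
        - signGauss v a.re w.re * signGauss v a.im (-w.im)‖
      ≤ ‖signChar v a.re w.re - signGauss v a.re w.re‖
        + ‖signChar v a.im (-w.im) - signGauss v a.im (-w.im)‖ := by
    rw [show signChar v a.re w.re * signChar v a.im (-w.im)
        - signGauss v a.re w.re * signGauss v a.im (-w.im)
      = (signChar v a.re w.re - signGauss v a.re w.re) * signChar v a.im (-w.im)
        + signGauss v a.re w.re * (signChar v a.im (-w.im) - signGauss v a.im (-w.im)) by ring]
    refine (norm_add_le _ _).trans (add_le_add ?_ ?_)
    · rw [norm_mul]
      exact mul_le_of_le_one_right (norm_nonneg _) (norm_signChar_le_one _ _ _)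
    · rw [norm_mul]
      exact mul_le_of_le_one_left (norm_nonneg _) (norm_signGauss_le_one _ _ _)
  rw [hsq]
  linarith

/-- No error arises here: the phases of the Gaussian factors add up to the phase of the centring and
cancel it, and dividing by `√2 ‖f‖` makes the squared weights sum to `‖t‖² / 2`. -/
theorem cexp_mul_prod_signGauss {N : ℕ} {f : EuclideanSpace ℂ (Fin N)} (hf : f ≠ 0)
    (r : Fin N → ℂ) (v : ℝ≥0) (t : ℂ) :
    Complex.exp (-((inner ℝ (signGain v * filterOutput f r / (√(2 * ‖f‖ ^ 2) : ℝ)) t : ℝ)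
        * Complex.I)) *
      ∏ n, (signGauss v (r n).re (star (f n) * star t / (√(2 * ‖f‖ ^ 2) : ℝ)).re *
        signGauss v (r n).im (-(star (f n) * star t / (√(2 * ‖f‖ ^ 2) : ℝ)).im))
      = Complex.exp (-(‖t‖ ^ 2 / 4 : ℝ)) := by
  set s := √(2 * ‖f‖ ^ 2)
  have hfpos : 0 < ‖f‖ := norm_pos_iff.2 hf
  have hs2 : s ^ 2 = 2 * ‖f‖ ^ 2 := Real.sq_sqrt (by positivity)
  have hsum : ∑ n, ‖f n‖ ^ 2 = ‖f‖ ^ 2 := (EuclideanSpace.norm_sq_eq f).symm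
  set w : Fin N → ℂ := fun n => star (f n) * star t / s with hw
  have hinner : inner ℝ (signGain v * filterOutput f r / (s : ℂ)) t
      = ∑ n, ((w n).re * (signGain v * (r n).re) + -(w n).im * (signGain v * (r n).im)) := by
    rw [real_inner_comm, Complex.inner, filterOutput_eq_sum]
    rw [show (signGain v * (∑ n, star (f n) * r n) / (s : ℂ)) * (starRingEnd ℂ) t
      = ∑ n, (signGain v : ℂ) * (w n * r n) by
        rw [← Finset.mul_sum, mul_div_assoc, mul_assoc, Finset.sum_div, Finset.sum_mul]
        congr 1
        refine Finset.sum_congr rfl fun n _ => ?_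
        rw [hw, starRingEnd_apply]; ring, Complex.re_sum]
    refine Finset.sum_congr rfl fun n _ => ?_
    rw [Complex.re_ofReal_mul, Complex.mul_re]
    ring
  have hwsum : ∑ n, ‖w n‖ ^ 2 = ‖t‖ ^ 2 / 2 := by
    have : ∀ n, ‖w n‖ ^ 2 = ‖f n‖ ^ 2 * (‖t‖ ^ 2 / s ^ 2) := fun n => by
      simp only [hw, norm_div, norm_mul, norm_star, Complex.norm_real, Real.norm_eq_abs, div_pow,
        mul_pow, sq_abs]
      ring
    simp only [this]
    rw [← Finset.sum_mul, hsum, hs2]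
    field_simp
  have hsq (n : Fin N) : ‖w n‖ ^ 2 = (w n).re ^ 2 + (-(w n).im) ^ 2 := by
    rw [Complex.sq_norm, Complex.normSq_apply]; ring
  change _ * ∏ n, (signGauss v (r n).re (w n).re * signGauss v (r n).im (-(w n).im)) = _
  simp only [signGauss, ← Complex.exp_add]
  rw [← Complex.exp_sum, ← Complex.exp_add, hinner]
  congr 1
  rw [show ‖t‖ ^ 2 / 4 = (∑ n, ((w n).re ^ 2 + (-(w n).im) ^ 2)) / 2 by
    rw [← Finset.sum_congr rfl fun n _ => hsq n, hwsum]; ring]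
  push_cast
  rw [Finset.sum_mul, Finset.sum_div, ← Finset.sum_neg_distrib, ← Finset.sum_neg_distrib,
    ← Finset.sum_add_distrib]
  exact Finset.sum_congr rfl fun n _ => by ring

theorem norm_charFun_map_quantOutput_sub_le {N : ℕ} {f : EuclideanSpace ℂ (Fin N)} (hf : f ≠ 0)
    (r : Fin N → ℂ) {v : ℝ≥0} (hv : v ≠ 0) (t : ℂ) {η δ : ℝ} (hη : η * ‖t‖ ≤ 1)
    (hfη : ∀ n, ‖f n‖ ≤ η * ‖f‖) (hr : ∀ n, ‖r n‖ ≤ δ) (hδ : signGain (v / 2) * δ ≤ 1 / 2) :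
    ‖charFun ((awgn N v).map fun y =>
        (quantOutput f r y - signGain (v / 2) * filterOutput f r) / (√(2 * ‖f‖ ^ 2) : ℝ)) t
      - charFun (complexGaussian 0 1) t‖
      ≤ (3 * (η * ‖t‖) + (signErr (v / 2) + signGain (v / 2) ^ 2) * δ ^ 2) * (‖t‖ ^ 2 / 2)
        + 2 * signErr (v / 2) * (N * δ ^ 4) := by
  have hv2 : v / 2 ≠ 0 := div_ne_zero hv two_ne_zero
  have hfpos : 0 < ‖f‖ := norm_pos_iff.2 hf
  have hsum : ∑ n, ‖f n‖ ^ 2 = ‖f‖ ^ 2 := (EuclideanSpace.norm_sq_eq f).symm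
  -- The limit is written as the same centring phase times the Gaussian product; this phase has
  -- modulus 1 and drops out.
  rw [charFun_map_quantOutput, charFun_complexGaussian, NNReal.coe_one, one_mul,
    ← cexp_mul_prod_signGauss hf r (v / 2) t, ← mul_sub, norm_mul, ← neg_mul, ← Complex.ofReal_neg,
    Complex.norm_exp_ofReal_mul_I, one_mul]
  set s := √(2 * ‖f‖ ^ 2)
  have hs2 : s ^ 2 = 2 * ‖f‖ ^ 2 := Real.sq_sqrt (by positivity)
  have hs : ‖f‖ ≤ s := Real.le_sqrt_of_sq_le (by nlinarith)
  have hspos : 0 < s := hfpos.trans_le hs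
  have hwn (n : Fin N) : ‖star (f n) * star t / (s : ℂ)‖ = ‖f n‖ * ‖t‖ / s := by
    rw [norm_div, norm_mul, norm_star, norm_star, Complex.norm_real, Real.norm_of_nonneg hspos.le]
  have hw (n : Fin N) : ‖star (f n) * star t / (s : ℂ)‖ ≤ η * ‖t‖ := by
    rw [hwn, div_le_iff₀ hspos]
    have hη0 : 0 ≤ η := nonneg_of_mul_nonneg_left ((norm_nonneg _).trans (hfη n)) hfpos
    calc ‖f n‖ * ‖t‖ ≤ η * ‖f‖ * ‖t‖ := by gcongr; exact hfη n
      _ ≤ η * s * ‖t‖ := by gcongr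
      _ = η * ‖t‖ * s := by ring
  refine (norm_prod_sub_prod_le _ _ _ (fun n => ?_) fun n => ?_).trans
    ((Finset.sum_le_sum fun n _ =>
      norm_signChar_mul_sub_signGauss_mul_le hv2 hη (hw n) (hr n) hδ).trans_eq ?_)
  · rw [norm_mul]
    exact mul_le_one₀ (norm_signChar_le_one _ _ _) (norm_nonneg _) (norm_signChar_le_one _ _ _)
  · rw [norm_mul]
    exact mul_le_one₀ (norm_signGauss_le_one _ _ _) (norm_nonneg _) (norm_signGauss_le_one _ _ _)
  · rw [Finset.sum_add_distrib, ← Finset.mul_sum]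
    have : ∑ n, ‖star (f n) * star t / (s : ℂ)‖ ^ 2 = ‖t‖ ^ 2 / 2 := by
      simp only [hwn, div_pow, mul_pow]
      rw [← Finset.sum_div, ← Finset.sum_mul, hsum, hs2]
      field_simp
    rw [this]
    simp
    ring

/-! ### The size of the received signal -/

theorem norm_steering (N : ℕ) (θ : ℝ) (k : Fin N) : ‖steering N θ k‖ = 1 / √(N : ℝ) := by
  have h : -(Complex.I * Real.pi * (k : ℕ) * Real.sin θ)
      = ((-(Real.pi * (k : ℕ) * Real.sin θ) : ℝ) : ℂ) * Complex.I := by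
    push_cast; ring
  rw [steering, norm_mul, h, Complex.norm_exp_ofReal_mul_I, mul_one, Complex.norm_real,
    Real.norm_of_nonneg (by positivity)]

theorem norm_of_mem_dacAlphabet {E : ℝ} {NT : ℕ} {w : ℂ} (hw : w ∈ dacAlphabet E NT) :
    ‖w‖ = √(E / (2 * NT)) := by
  have h : ‖((√(E / (2 * NT)) : ℝ) : ℂ)‖ = √(E / (2 * NT)) := by
    rw [Complex.norm_real, Real.norm_of_nonneg (Real.sqrt_nonneg _)]
  simp only [dacAlphabet, Set.mem_insert_iff, Set.mem_singleton_iff] at hw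
  rcases hw with rfl | rfl | rfl | rfl <;> simp only [norm_neg, norm_mul, Complex.norm_I, one_mul, h]

theorem norm_channel_mulVec_le (NR : ℕ) {NT : ℕ} (θ : ℝ) {E : ℝ} {x : Fin NT → ℂ}
    (hx : ∀ k, x k ∈ dacAlphabet E NT) (n : Fin NR) :
    ‖(channel NR NT θ).mulVec x n‖ ≤ NT * (1 / √(NT : ℝ) * √(E / (2 * NT))) / √(NR : ℝ) := by
  have h : (channel NR NT θ).mulVec x n = steering NR θ n * ∑ k, steering NT θ k * x k := by
    simp only [Matrix.mulVec, dotProduct, channel, Matrix.vecMulVec_apply, mul_assoc,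
      Finset.mul_sum]
  rw [h, norm_mul, norm_steering]
  have h2 : ‖∑ k, steering NT θ k * x k‖ ≤ ∑ _k : Fin NT, 1 / √(NT : ℝ) * √(E / (2 * NT)) :=
    norm_sum_le_of_le _ fun k _ => by
      rw [norm_mul, norm_steering, norm_of_mem_dacAlphabet (hx k)]
  rw [Finset.sum_const, Finset.card_univ, Fintype.card_fin, nsmul_eq_mul] at h2
  calc _ ≤ 1 / √(NR : ℝ) * (NT * (1 / √(NT : ℝ) * √(E / (2 * NT)))) := by gcongr
    _ = _ := by ring

/-- The point is uniformity: `B` depends on the scene alone, not on the number of receive antennas,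
the transmit vector or the hypothesis. -/
theorem exists_norm_received_le (Q NT : ℕ) (θ : Fin (Q + 1) → ℝ) (γ : Fin (Q + 1) → ℂ) (E : ℝ) :
    ∃ B : ℝ, ∀ (NR : ℕ) (x : Fin NT → ℂ), (∀ k, x k ∈ dacAlphabet E NT) → ∀ (i : Hypothesis) n,
      ‖received Q NR NT θ γ x i n‖ ≤ B / √(NR : ℝ) := by
  set b : ℝ := NT * (1 / √(NT : ℝ) * √(E / (2 * NT)))
  have hb : 0 ≤ b := by positivity
  refine ⟨‖γ 0‖ * b + ∑ q : Fin Q, ‖γ q.succ‖ * b, fun NR x hx i n => ?_⟩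
  have hq (q : Fin (Q + 1)) :
      ‖(γ q • (channel NR NT (θ q)).mulVec x) n‖ ≤ ‖γ q‖ * b / √(NR : ℝ) := by
    rw [Pi.smul_apply, norm_smul, mul_div_assoc]
    exact mul_le_mul_of_nonneg_left (norm_channel_mulVec_le NR (θ q) hx n) (norm_nonneg _)
  have hclutter : ‖(∑ q : Fin Q, γ q.succ • (channel NR NT (θ q.succ)).mulVec x) n‖
      ≤ (∑ q : Fin Q, ‖γ q.succ‖ * b) / √(NR : ℝ) := by
    rw [Finset.sum_apply, Finset.sum_div]
    exact norm_sum_le_of_le _ fun q _ => hq q.succ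
  rw [add_div]
  cases i with
  | H0 => exact hclutter.trans (le_add_of_nonneg_left (by positivity))
  | H1 =>
    simp only [received, Pi.add_apply]
    exact (norm_add_le _ _).trans (add_le_add (hq 0) hclutter)

/-! ### Asymptotics in the number of antennas -/

/-- The decay rate `1/√N` is used here: `N` error terms of order `δ⁴` still sum to `B⁴/N`. -/
theorem tendsto_natCast_mul_div_sqrt_pow_four (B : ℝ) :
    Tendsto (fun N : ℕ => (N : ℝ) * (B / √(N : ℝ)) ^ 4) atTop (𝓝 0) := by
  have h : Tendsto (fun N : ℕ => B ^ 4 / (N : ℝ)) atTop (𝓝 0) :=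
    tendsto_const_nhds.div_atTop tendsto_natCast_atTop_atTop
  refine h.congr fun N => ?_
  rcases Nat.eq_zero_or_pos N with rfl | hN
  · simp
  · have hN' : (0 : ℝ) < N := by exact_mod_cast hN
    rw [div_pow, show √(N : ℝ) ^ 4 = (√(N : ℝ) ^ 2) ^ 2 by ring, Real.sq_sqrt hN'.le]
    field_simp

theorem tendsto_div_sqrt_natCast (B : ℝ) :
    Tendsto (fun N : ℕ => B / √(N : ℝ)) atTop (𝓝 0) :=
  tendsto_const_nhds.div_atTop (Real.tendsto_sqrt_atTop.comp tendsto_natCast_atTop_atTop)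

section Limits

variable {f : ∀ N : ℕ, EuclideanSpace ℂ (Fin N)} {r : ∀ N : ℕ, Fin N → ℂ} {B : ℝ} {v : ℝ≥0}

theorem tendsto_charFun_map_quantOutput (hv : v ≠ 0) (hf0 : ∀ᶠ N in atTop, f N ≠ 0)
    (hf : ∀ ε > (0 : ℝ), ∀ᶠ N in atTop, ∀ n, ‖f N n‖ ≤ ε * ‖f N‖)
    (hr : ∀ N n, ‖r N n‖ ≤ B / √(N : ℝ)) (t : ℂ) :
    Tendsto (fun N => charFun ((awgn N v).map fun y =>
        (quantOutput (f N) (r N) y - signGain (v / 2) * filterOutput (f N) (r N))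
          / (√(2 * ‖f N‖ ^ 2) : ℝ)) t) atTop (𝓝 (charFun (complexGaussian 0 1) t)) := by
  -- The norm of `ofLp` is the sup norm, so `η` is the largest relative filter weight.
  set η : ℕ → ℝ := fun N => ‖(f N).ofLp‖ / ‖f N‖
  have hη : Tendsto η atTop (𝓝 0) := by
    rw [Metric.tendsto_nhds]
    intro ε hε
    filter_upwards [hf (ε / 2) (half_pos hε), hf0] with N hN hN0
    have hpos : 0 < ‖f N‖ := norm_pos_iff.2 hN0
    rw [Real.dist_0_eq_abs, abs_of_nonneg (by positivity), div_lt_iff₀ hpos]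
    refine ((pi_norm_le_iff_of_nonneg (by positivity)).2 hN).trans_lt ?_
    nlinarith
  have hδ := tendsto_div_sqrt_natCast B
  have hbound : Tendsto (fun N : ℕ =>
      (3 * (η N * ‖t‖) + (signErr (v / 2) + signGain (v / 2) ^ 2) * (B / √(N : ℝ)) ^ 2)
        * (‖t‖ ^ 2 / 2) + 2 * signErr (v / 2) * (N * (B / √(N : ℝ)) ^ 4)) atTop (𝓝 0) := by
    have h := ((((hη.mul_const ‖t‖).const_mul 3).add
      ((hδ.pow 2).const_mul (signErr (v / 2) + signGain (v / 2) ^ 2))).mul_const (‖t‖ ^ 2 / 2)).add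
      ((tendsto_natCast_mul_div_sqrt_pow_four B).const_mul (2 * signErr (v / 2)))
    simpa using h
  rw [tendsto_iff_norm_sub_tendsto_zero]
  refine squeeze_zero' (Eventually.of_forall fun _ => norm_nonneg _) ?_ hbound
  have e1 : ∀ᶠ N in atTop, η N * ‖t‖ ≤ 1 := by
    have := hη.mul_const ‖t‖
    rw [zero_mul] at this
    exact this.eventually_le_const one_pos
  have e2 : ∀ᶠ N : ℕ in atTop, signGain (v / 2) * (B / √(N : ℝ)) ≤ 1 / 2 := by
    have := hδ.const_mul (signGain (v / 2))
    rw [mul_zero] at this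
    exact this.eventually_le_const (by norm_num)
  filter_upwards [hf0, e1, e2] with N h0 h1 h2
  refine norm_charFun_map_quantOutput_sub_le h0 (r N) hv t h1 (fun n => ?_) (hr N) h2
  rw [div_mul_cancel₀ _ (norm_ne_zero_iff.2 h0)]
  exact norm_le_pi_norm (f N).ofLp n

theorem tendsto_integral_quantOutput (hv : v ≠ 0) (hf0 : ∀ᶠ N in atTop, f N ≠ 0)
    (hr : ∀ N n, ‖r N n‖ ≤ B / √(N : ℝ)) :
    Tendsto (fun N => (∫ y, quantOutput (f N) (r N) y ∂awgn N v
      - signGain (v / 2) * filterOutput (f N) (r N)) / (√(2 * ‖f N‖ ^ 2) : ℂ)) atTop (𝓝 0) := by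
  have hbound : Tendsto (fun N : ℕ => 2 * signErr (v / 2) *
      ((B / √(N : ℝ)) ^ 2 + N * (B / √(N : ℝ)) ^ 4)) atTop (𝓝 0) := by
    have h := (((tendsto_div_sqrt_natCast B).pow 2).add
      (tendsto_natCast_mul_div_sqrt_pow_four B)).const_mul (2 * signErr (v / 2))
    simpa using h
  refine squeeze_zero_norm' ?_ hbound
  filter_upwards [hf0] with N hN
  have hpos : 0 < ‖f N‖ := norm_pos_iff.2 hN
  have hs : ‖f N‖ ≤ √(2 * ‖f N‖ ^ 2) := Real.le_sqrt_of_sq_le (by nlinarith)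
  have hk := signErr_nonneg (v / 2)
  rw [norm_div, Complex.norm_real, Real.norm_of_nonneg (Real.sqrt_nonneg _),
    div_le_iff₀ (hpos.trans_le hs)]
  refine (norm_integral_quantOutput_sub_le (f N) (r N) hv (hr N)).trans ?_
  rw [← mul_assoc]
  gcongr

theorem tendsto_integral_norm_quantOutput_sub_sq (hv : v ≠ 0) (hf0 : ∀ᶠ N in atTop, f N ≠ 0)
    (hr : ∀ N n, ‖r N n‖ ≤ B / √(N : ℝ)) :
    Tendsto (fun N => (∫ y, ‖quantOutput (f N) (r N) y
      - ∫ y', quantOutput (f N) (r N) y' ∂awgn N v‖ ^ 2 ∂awgn N v) / (2 * ‖f N‖ ^ 2))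
      atTop (𝓝 1) := by
  have hbound : Tendsto (fun N : ℕ => (2 * signGain (v / 2) * (B / √(N : ℝ))) ^ 2) atTop (𝓝 0) := by
    have h := ((tendsto_div_sqrt_natCast B).const_mul (2 * signGain (v / 2))).pow 2
    simpa using h
  rw [tendsto_iff_norm_sub_tendsto_zero]
  refine squeeze_zero' (Eventually.of_forall fun _ => norm_nonneg _) ?_ hbound
  filter_upwards [hf0] with N hN
  have hpos : 0 < ‖f N‖ := norm_pos_iff.2 hN
  have hpos2 : 0 < 2 * ‖f N‖ ^ 2 := by positivity
  rw [div_sub_one hpos2.ne', norm_div, Real.norm_of_nonneg hpos2.le, div_le_iff₀ hpos2]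
  refine (abs_integral_norm_quantOutput_sub_sq_sub_le (f N) (r N) hv (hr N)).trans ?_
  gcongr
  nlinarith [sq_nonneg ‖f N‖]

end Limits

/-- Each real component carries half of the noise power, which turns the slope of the sign mean into
the gain appearing in `m`. -/
theorem signGain_half_sq (σ : ℝ≥0) : signGain (σ ^ 2 / 2) = 2 / √(Real.pi * σ ^ 2) := by
  rw [signGain]
  congr 2
  push_cast
  ring

end OneBitRadar

open OneBitRadar in
theorem theorem1
    -- the fixed scene: clutter sources, transmit antennas, angles, amplitudes, power, noise level
    (Q NT : ℕ) (θ : Fin (Q + 1) → ℝ) (γ : Fin (Q + 1) → ℂ) (E : ℝ) (σ : ℝ≥0) (hσ : 0 < σ)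
    -- the 1-bit transmit signal and the receive filter, for every number of receive antennas
    (x : ℕ → Fin NT → ℂ) (hx : ∀ NR k, x NR k ∈ dacAlphabet E NT)
    (f : ∀ NR : ℕ, EuclideanSpace ℂ (Fin NR)) (hf0 : ∀ᶠ NR in atTop, f NR ≠ 0)
    -- no single antenna dominates the filter
    (hf : ∀ ε > (0 : ℝ), ∀ᶠ NR in atTop, ∀ n, ‖f NR n‖ ≤ ε * ‖f NR‖)
    -- the receiver noise
    {Ω : ℕ → Type*} [∀ NR, MeasurableSpace (Ω NR)] (P : ∀ NR, Measure (Ω NR))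
    [∀ NR, IsProbabilityMeasure (P NR)] (noise : ∀ NR, Ω NR → Fin NR → ℂ)
    (hnoise : ∀ NR, HasLaw (noise NR) (awgn NR (σ ^ 2)) (P NR))
    (i : Hypothesis) :
    let r : ∀ NR : ℕ, Fin NR → ℂ := fun NR => received Q NR NT θ γ (x NR) i
    let z : ∀ NR, Ω NR → ℂ := fun NR ω =>
      filterOutput (f NR) (fun n => quantize (r NR n + noise NR ω n))
    let m : ℕ → ℂ := fun NR => (2 / √(Real.pi * σ ^ 2) : ℝ) * filterOutput (f NR) (r NR)
    -- low SNR / CNR at every receive antenna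
    (∀ ε > (0 : ℝ), ∀ᶠ NR in atTop, ∀ n, ‖r NR n‖ ^ 2 ≤ ε * (σ : ℝ) ^ 2) ∧
    -- the limit law
    IsAsymptoticallyComplexGaussian P z m (fun NR => 2 * ‖f NR‖ ^ 2) ∧
    -- mean and variance
    Tendsto (fun NR => (∫ ω, z NR ω ∂(P NR) - m NR) / (√(2 * ‖f NR‖ ^ 2) : ℂ)) atTop (𝓝 0) ∧
    Tendsto (fun NR => (∫ ω, ‖z NR ω - ∫ ω', z NR ω' ∂(P NR)‖ ^ 2 ∂(P NR)) / (2 * ‖f NR‖ ^ 2))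
      atTop (𝓝 1) := by
  intro r z m
  have hv : σ ^ 2 ≠ 0 := pow_ne_zero _ hσ.ne'
  obtain ⟨B, hB⟩ := exists_norm_received_le Q NT θ γ E
  have hr : ∀ N n, ‖r N n‖ ≤ B / √(N : ℝ) := fun N n => hB N (x N) (hx N) i n
  have hm : ∀ N, m N = signGain (σ ^ 2 / 2) * filterOutput (f N) (r N) := fun N => by
    rw [signGain_half_sq]
  have hmeas N := measurable_quantOutput (f N) (r N)
  -- Everything depends on the noise through its law only, so the computation moves to `awgn`.
  have hint : ∀ N, ∫ ω, z N ω ∂P N = ∫ y, quantOutput (f N) (r N) y ∂awgn N (σ ^ 2) := fun N =>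
    (hnoise N).integral_comp (hmeas N).aestronglyMeasurable
  refine ⟨fun ε hε => ?_, ⟨?_, ?_⟩, ?_, ?_⟩
  · have hσ2 : 0 < (σ : ℝ) ^ 2 := by positivity
    have h := (tendsto_div_sqrt_natCast B).pow 2
    rw [zero_pow two_ne_zero] at h
    filter_upwards [h.eventually_le_const (mul_pos hε hσ2)] with N hN n
    exact (pow_le_pow_left₀ (norm_nonneg _) (hr N n) 2).trans hN
  · filter_upwards [hf0] with N hN
    have := norm_pos_iff.2 hN
    positivity
  · have hmeas' N : Measurable fun y =>
        (quantOutput (f N) (r N) y - m N) / (√(2 * ‖f N‖ ^ 2) : ℂ) :=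
      ((hmeas N).sub_const _).div_const _
    refine ⟨fun N => (hmeas' N).comp_aemeasurable (hnoise N).aemeasurable, aemeasurable_id, ?_⟩
    -- Lévy's continuity theorem reduces weak convergence to pointwise convergence of characteristic
    -- functions.
    refine ProbabilityMeasure.tendsto_iff_tendsto_charFun.2 fun t => ?_
    have h := tendsto_charFun_map_quantOutput hv hf0 hf hr t
    simp only [ProbabilityMeasure.coe_mk, Measure.map_id]
    refine h.congr fun N => ?_
    rw [← hm, ← (hnoise N).map_eq,
      AEMeasurable.map_map_of_aemeasurable (hmeas' N).aemeasurable (hnoise N).aemeasurable]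
    rfl
  · simp only [hint, hm]
    exact tendsto_integral_quantOutput hv hf0 hr
  · simp only [hint]
    refine (tendsto_integral_norm_quantOutput_sub_sq hv hf0 hr).congr fun N => ?_
    congr 1
    refine ((hnoise N).integral_comp (f := fun y => ‖quantOutput (f N) (r N) y
      - ∫ y', quantOutput (f N) (r N) y' ∂awgn N (σ ^ 2)‖ ^ 2) ?_).symm
    exact (((hmeas N).sub_const _).norm.pow_const 2).aestronglyMeasurable
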